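/- Let $N\ge 0$ be an integer and let $P(t)=a_0+\sum_{k=1}^N\big(a_k\cos(kt)+b_k\sin(kt)\big)$ be a trigonometric polynomial with real coefficients that has a smallest period $h>0$ (that is, $P$ is non-constant). Suppose that $P(0)=P'(0)=P''(0)=0$ and $P(t)\ge 0$ for $0<t<h$. Then there is $c_0>0$, depending only on $P$, such that for every $c\in(0,c_0)$ the following holds. The function $$L(t)=(1-cP(t))\,e^{t^2/2},\qquad t\in\mathbb R,$$ is the Laplace transform $L(t)=\mathbb E\,e^{tX}$ of a strictly subgaussian random variable $X$ with $\operatorname{Var}(X)=1$, i.e. $\mathbb E X=0$ and $\mathbb E\,e^{tX}\le e^{\sigma^2t^2/2}$ for all $t\in\mathbb R$, where $\sigma^2=\operatorname{Var}(X)=1$. Moreover, $X$ has a density of the form $q(x)\varphi(x)$, where $\varphi(x)=\frac1{\sqrt{2\pi}}e^{-x^2/2}$ and $q$ is a non-negative trigonometric polynomial of degree at most $N$. If in addition $P(t)>0$ for $0<t<h$, then, for independent copies $X_1,X_2,\dots$ of $X$, the normalized sums $Z_n=(X_1+\dots+X_n)/\sqrt n$, $n\ge1$, have densities $p_n$ with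 $$T_\infty(p_n\|\varphi)=\operatorname*{ess\,sup}_{x\in\mathbb R}\frac{p_n(x)-\varphi(x)}{\varphi(x)}\;\longrightarrow\;0\qquad(n\to\infty).$$ -/

import Mathlib

open Real MeasureTheory ProbabilityTheory Filter Topology

noncomputable section

/-- `P` is a real trigonometric polynomial of degree at most `N`:
`P(t) = a₀ + ∑_{k=1}^N (aₖ cos(kt) + bₖ sin(kt))` with real coefficients. -/
def IsTrigPoly (N : ℕ) (P : ℝ → ℝ) : Prop :=
  ∃ a b : ℕ → ℝ, ∀ t : ℝ,
    P t = a 0 + ∑ k ∈ Finset.Icc 1 N, (a k * Real.cos (k * t) + b k * Real.sin (k * t))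

/-- `h` is the smallest (positive) period of `P`. -/
def IsSmallestPeriod (P : ℝ → ℝ) (h : ℝ) : Prop :=
  IsLeast {s : ℝ | 0 < s ∧ Function.Periodic P s} h

/-- The standard normal density `φ(x) = (2π)^{-1/2} exp(-x²/2)`. -/
def stdNormalDensity (x : ℝ) : ℝ := (√(2 * π))⁻¹ * Real.exp (-x ^ 2 / 2)

/-- `p` is a density (with respect to Lebesgue measure) of the law `ν` on the line. -/
structure IsDensity (p : ℝ → ℝ) (ν : Measure ℝ) : Prop where
  measurable : Measurable p
  nonneg : ∀ x, 0 ≤ p x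
  eq_withDensity : ν = volume.withDensity (fun x => ENNReal.ofReal (p x))

/-- `ℒ(t) = E e^{tX}` for all real `t`, the expectation being finite. -/
def HasLaplaceTransform {Ω : Type*} [MeasurableSpace Ω] (X : Ω → ℝ) (Pr : Measure Ω)
    (ℒ : ℝ → ℝ) : Prop :=
  ∀ t : ℝ, Integrable (fun ω => Real.exp (t * X ω)) Pr ∧
    ∫ ω, Real.exp (t * X ω) ∂Pr = ℒ t

/-- `X` is strictly subgaussian: it has mean zero and `E e^{tX} ≤ e^{σ² t² / 2}` for all real `t`,
where `σ² = Var(X)`. Finiteness of all exponential moments is part of the definition, and it makes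
the mean and the variance genuine. -/
structure IsStrictlySubgaussian {Ω : Type*} [MeasurableSpace Ω] (X : Ω → ℝ) (Pr : Measure Ω) :
    Prop where
  aemeasurable : AEMeasurable X Pr
  integrable_exp : ∀ t : ℝ, Integrable (fun ω => Real.exp (t * X ω)) Pr
  mean_zero : ∫ ω, X ω ∂Pr = 0
  laplace_le : ∀ t : ℝ,
    ∫ ω, Real.exp (t * X ω) ∂Pr ≤ Real.exp (variance X Pr * t ^ 2 / 2)

/-- The Tsallis distance of infinite order to the standard normal law,
`T_∞(p‖φ) = ess sup_x (p(x) - φ(x)) / φ(x)`, as an extended real number. -/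
def tsallisInfty (p : ℝ → ℝ) : EReal :=
  essSup (fun x : ℝ => (((p x - stdNormalDensity x) / stdNormalDensity x : ℝ) : EReal)) volume

/-- The normalized sum `Z_n = (X_1 + ⋯ + X_n) / √n` (the sequence is indexed from `0`). -/
def normalizedSum {Ω : Type*} (X : ℕ → Ω → ℝ) (n : ℕ) (ω : Ω) : ℝ :=
  (∑ k ∈ Finset.range n, X k ω) / √(n : ℝ)

end

/-! Averaging an exponential sum over `x + iG`, with `G` standard normal (`gaussT`), inverts the
heat flow: frequency `k` is multiplied by `exp (k²/2)`, and the average times `φ` has Laplace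
transform `f(w) exp (w²/2)` (`gaussT_laplace`). Hence the average `q` of `1 - cP` is an explicit
trigonometric polynomial, non-negative for small `c`, and `qφ` is the required density. The mass is
1 because `P(0) = 0`; mean 0 and variance 1 come from `P'(0) = P''(0) = 0`, and the subgaussian
bound from `P ≥ 0`.

For `Z_n` the ratio of densities is the average of `(1 - cP(z/√n))^n`. It is bounded uniformly in
`x` once `|1 - cP(y + iu)|` is at most `exp (u²/4)` everywhere and at most `exp (Du⁴)` for `|u| ≤ 1`
(`exists_norm_one_sub_le`); by dominated convergence the bound tends to 1. The lower bound is
automatic, since both densities integrate to 1 (`tsallisInfty_nonneg`).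

The quartic bound is the crux. In `Re P(y + iu) = P - u²P''/2 + O(u⁴)` the term `u²P''` is absorbed
by `P` as soon as `P''² ≤ KP`. This holds because a non-negative `P` vanishing to third order at 0
vanishes to fourth order, and strict positivity excludes other zeros within a period
(`exists_deriv_sq_le`). -/

/-! ### Exponential sums and Gaussian averaging. -/

/-- The multiplicative monoid of the functions `z ↦ exp (i l z)` with real frequency `l`. -/
def expMonoid : Submonoid (ℂ → ℂ) where
  carrier := {f | ∃ l : ℝ, f = fun z => Complex.exp (Complex.I * l * z)}
  one_mem' := ⟨0, by ext z; simp⟩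
  mul_mem' := by
    rintro _ _ ⟨l, rfl⟩ ⟨m, rfl⟩
    refine ⟨l + m, ?_⟩
    ext z
    simp only [Pi.mul_apply, ← Complex.exp_add]
    congr 1
    push_cast
    ring

/-- The algebra of exponential sums with real frequencies. -/
def expSum : Subalgebra ℂ (ℂ → ℂ) := Algebra.adjoin ℂ (expMonoid : Set (ℂ → ℂ))

lemma exp_mem_expSum (l : ℝ) : (fun z : ℂ => Complex.exp (Complex.I * l * z)) ∈ expSum :=
  Algebra.subset_adjoin ⟨l, rfl⟩

lemma cos_mem_expSum (l : ℝ) : (fun z : ℂ => Complex.cos (l * z)) ∈ expSum := by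
  have h := expSum.smul_mem (expSum.add_mem (exp_mem_expSum l) (exp_mem_expSum (-l))) (1 / 2 : ℂ)
  convert! h using 1
  ext z
  simp only [Complex.cos, Pi.smul_apply, Pi.add_apply, smul_eq_mul]
  push_cast
  ring_nf

lemma sin_mem_expSum (l : ℝ) : (fun z : ℂ => Complex.sin (l * z)) ∈ expSum := by
  have h := expSum.smul_mem (expSum.sub_mem (exp_mem_expSum (-l)) (exp_mem_expSum l))
    (Complex.I / 2 : ℂ)
  convert! h using 1
  ext z
  simp only [Complex.sin, Pi.smul_apply, Pi.sub_apply, smul_eq_mul]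
  push_cast
  ring_nf

/-- The exponentials are closed under products, so the algebra they generate is their linear span;
linear statements need checking on one exponential only, while powers remain available. -/
lemma expSum_induction {p : (ℂ → ℂ) → Prop}
    (hexp : ∀ l : ℝ, p fun z => Complex.exp (Complex.I * l * z))
    (hzero : p 0) (hadd : ∀ f g, p f → p g → p (f + g)) (hsmul : ∀ (c : ℂ) f, p f → p (c • f))
    {f : ℂ → ℂ} (hf : f ∈ expSum) : p f := by
  have hf' : f ∈ Submodule.span ℂ (expMonoid : Set (ℂ → ℂ)) := by
    rw [← Submonoid.closure_eq expMonoid, ← Algebra.adjoin_eq_span]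
    exact hf
  refine Submodule.span_induction (p := fun f _ => p f) ?_ hzero
    (fun f g _ _ => hadd f g) (fun c f _ => hsmul c f) hf'
  rintro _ ⟨l, rfl⟩
  exact hexp l

lemma expSum_comp_mul {f : ℂ → ℂ} (hf : f ∈ expSum) (r : ℝ) : (fun z => f (r * z)) ∈ expSum := by
  refine expSum_induction (p := fun f => (fun z => f (r * z)) ∈ expSum) ?hexp ?hzero ?hadd ?hsmul hf
  case hexp =>
    intro l
    convert! exp_mem_expSum (l * r) using 1
    ext z
    push_cast
    ring_nf
  case hzero => exact expSum.zero_mem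
  case hadd =>
    intro f g h1 h2
    exact expSum.add_mem h1 h2
  case hsmul =>
    intro c f h
    exact expSum.smul_mem h c

/-- Gaussian averaging in the imaginary direction. -/
noncomputable def gaussT (f : ℂ → ℂ) (x : ℝ) : ℂ :=
  ∫ g : ℝ, f (x + Complex.I * g) ∂(gaussianReal 0 1)

lemma integral_cexp_gaussian (w : ℂ) :
    ∫ g : ℝ, Complex.exp (w * g) ∂(gaussianReal 0 1) = Complex.exp (w ^ 2 / 2) := by
  have := complexMGF_id_gaussianReal (μ := 0) (v := 1) w
  simpa [complexMGF] using this

lemma integrable_cexp_gaussian (w : ℂ) :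
    Integrable (fun g : ℝ => Complex.exp (w * g)) (gaussianReal 0 1) := by
  refine integrable_cexp_mul_of_re_mem_integrableExpSet (X := fun g : ℝ => g)
    (by fun_prop) ?_
  simp

lemma expSum_integrable {f : ℂ → ℂ} (hf : f ∈ expSum) (x : ℝ) :
    Integrable (fun g : ℝ => f (x + Complex.I * g)) (gaussianReal 0 1) := by
  refine expSum_induction (p := fun f =>
    Integrable (fun g : ℝ => f (x + Complex.I * g)) (gaussianReal 0 1)) ?hexp ?hzero ?hadd ?hsmul hf
  case hexp =>
    intro l
    convert! (integrable_cexp_gaussian (-l)).const_mul (Complex.exp (Complex.I * l * x)) using 1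
    ext g
    rw [← Complex.exp_add]
    refine congrArg Complex.exp ?_
    linear_combination l * g * Complex.I_sq
  case hzero => simp
  case hadd =>
    intro f g h1 h2
    exact h1.add h2
  case hsmul =>
    intro c f h
    exact h.smul c

lemma gaussT_exp (l x : ℝ) : gaussT (fun z => Complex.exp (Complex.I * l * z)) x =
    Complex.exp (l ^ 2 / 2) * Complex.exp (Complex.I * l * x) := by
  have (g : ℝ) : Complex.exp (Complex.I * l * (x + Complex.I * g)) =
      Complex.exp (Complex.I * l * x) * Complex.exp (-l * g) := by
    rw [← Complex.exp_add]
    congr 1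
    linear_combination l * g * Complex.I_sq
  simp only [gaussT, this]
  rw [integral_const_mul, integral_cexp_gaussian, mul_comm, neg_sq]

lemma gaussT_add {f g : ℂ → ℂ} (hf : f ∈ expSum) (hg : g ∈ expSum) :
    gaussT (f + g) = gaussT f + gaussT g := by
  ext x
  exact integral_add (expSum_integrable hf x) (expSum_integrable hg x)

lemma gaussT_smul (c : ℂ) (f : ℂ → ℂ) : gaussT (c • f) = c • gaussT f := by
  ext x
  exact integral_smul c _

/-- Gaussian averaging in the imaginary direction inverts the heat flow: the transform of `gaussT f`
against the normal law is `f w * exp (w ^ 2 / 2)`. -/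
lemma gaussT_laplace {f : ℂ → ℂ} (hf : f ∈ expSum) :
    Continuous (gaussT f) ∧
    ∀ w : ℂ, Integrable (fun x : ℝ => Complex.exp (w * x) * gaussT f x) (gaussianReal 0 1) ∧
      ∫ x : ℝ, Complex.exp (w * x) * gaussT f x ∂(gaussianReal 0 1) =
        f w * Complex.exp (w ^ 2 / 2) := by
  -- Membership is carried through the induction because additivity of `gaussT` needs the
  -- integrability it provides.
  suffices h : f ∈ expSum ∧ Continuous (gaussT f) ∧
    ∀ w : ℂ, Integrable (fun x : ℝ => Complex.exp (w * x) * gaussT f x) (gaussianReal 0 1) ∧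
      ∫ x : ℝ, Complex.exp (w * x) * gaussT f x ∂(gaussianReal 0 1) =
        f w * Complex.exp (w ^ 2 / 2) from h.2
  refine expSum_induction (p := fun f => f ∈ expSum ∧ Continuous (gaussT f) ∧
    ∀ w : ℂ, Integrable (fun x : ℝ => Complex.exp (w * x) * gaussT f x) (gaussianReal 0 1) ∧
      ∫ x : ℝ, Complex.exp (w * x) * gaussT f x ∂(gaussianReal 0 1) =
        f w * Complex.exp (w ^ 2 / 2)) ?hexp ?hzero ?hadd ?hsmul hf
  case hexp =>
    intro l
    have h0 : gaussT (fun z => Complex.exp (Complex.I * l * z)) =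
      fun x : ℝ => Complex.exp (l ^ 2 / 2) * Complex.exp (Complex.I * l * x) :=
      funext (gaussT_exp l)
    refine ⟨exp_mem_expSum l, by rw [h0]; fun_prop, fun w => ?_⟩
    have h1 (x : ℝ) : Complex.exp (w * x) * gaussT (fun z => Complex.exp (Complex.I * l * z)) x =
        Complex.exp (l ^ 2 / 2) * Complex.exp ((w + Complex.I * l) * x) := by
      rw [gaussT_exp, mul_left_comm, ← Complex.exp_add (w * x)]
      congr 2
      ring
    simp only [h1]
    refine ⟨(integrable_cexp_gaussian _).const_mul _, ?_⟩
    rw [integral_const_mul, integral_cexp_gaussian, ← Complex.exp_add, ← Complex.exp_add]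
    congr 1
    linear_combination (l ^ 2 : ℂ) / 2 * Complex.I_sq
  case hzero =>
    have : gaussT 0 = 0 := by ext; simp [gaussT]
    refine ⟨expSum.zero_mem, by rw [this]; exact continuous_zero, fun w => by simp [this]⟩
  case hadd =>
    intro f g h1 h2
    obtain ⟨hf, cf, h1⟩ := h1
    obtain ⟨hg, cg, h2⟩ := h2
    rw [gaussT_add hf hg]
    refine ⟨expSum.add_mem hf hg, cf.add cg, fun w => ?_⟩
    simp only [Pi.add_apply, mul_add, add_mul]
    exact ⟨(h1 w).1.add (h2 w).1, by rw [integral_add (h1 w).1 (h2 w).1, (h1 w).2, (h2 w).2]⟩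
  case hsmul =>
    intro c f h
    obtain ⟨hf, cf, h⟩ := h
    rw [gaussT_smul]
    refine ⟨expSum.smul_mem hf c, cf.const_smul c, fun w => ?_⟩
    simp only [Pi.smul_apply, smul_eq_mul, mul_left_comm _ c]
    exact ⟨(h w).1.const_mul c, by rw [integral_const_mul, (h w).2, mul_assoc]⟩

/-- If `f` is real on the real axis, in the sense of the reflection principle, then so is its
Gaussian average. -/
lemma gaussT_im {f : ℂ → ℂ} (hf : ∀ z, f (starRingEnd ℂ z) = starRingEnd ℂ (f z)) (x : ℝ) :
    (gaussT f x).im = 0 := by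
  rw [← Complex.conj_eq_iff_im, gaussT, ← integral_conj]
  -- Conjugation sends `x + ig` to `x - ig`, which the symmetry of the normal law undoes.
  have h : (gaussianReal 0 1).map (fun x : ℝ => -x) = gaussianReal 0 1 := by
    rw [gaussianReal_map_neg]; simp
  have h1 := ((Homeomorph.neg ℝ).measurableEmbedding).integral_map (μ := gaussianReal 0 1)
    fun g : ℝ => f (x + Complex.I * g)
  simp only [Homeomorph.coe_neg] at h1
  rw [show (Neg.neg : ℝ → ℝ) = fun x => -x from rfl, h] at h1
  rw [h1]
  refine integral_congr_ae (ae_of_all _ fun g => ?_)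
  simp [← hf]

/-! ### Densities from characteristic functions. -/

/-- A real function whose Fourier transform against a finite measure `γ` is the characteristic
function of a finite measure `ν` is the density of `ν`. -/
lemma eq_withDensity_of_charFun {ν γ : Measure ℝ} [IsFiniteMeasure ν]
    {q : ℝ → ℝ} (hq : Measurable q) (hint : Integrable q γ)
    (h : ∀ s : ℝ, charFun ν s = ∫ x : ℝ, Complex.exp (s * x * Complex.I) * q x ∂γ) :
    ν = γ.withDensity (fun x => ENNReal.ofReal (q x)) := by
  have fin (r : ℝ → ℝ) (hr : Integrable r γ) :
      IsFiniteMeasure (γ.withDensity fun x => ENNReal.ofReal (r x)) :=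
    isFiniteMeasure_withDensity_ofReal hr.2
  have := fin q hint
  have := fin (fun x => - q x) hint.neg
  have hch (r : ℝ → ℝ) (hr : Measurable r) (s : ℝ) :
      charFun (γ.withDensity fun x => ENNReal.ofReal (r x)) s =
        ∫ x : ℝ, Complex.exp (s * x * Complex.I) * (max (r x) 0 : ℝ) ∂γ := by
    rw [charFun_apply_real, integral_withDensity_eq_integral_toReal_smul
      (by fun_prop) (by simp)]
    refine integral_congr_ae (ae_of_all _ fun x => ?_)
    simp [ENNReal.toReal_ofReal', mul_comm]
  have hI (r : ℝ → ℝ) (hr : Integrable r γ) (s : ℝ) :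
      Integrable (fun x : ℝ => Complex.exp (s * x * Complex.I) * (max (r x) 0 : ℝ)) γ := by
    refine hr.pos_part.ofReal.bdd_mul (c := 1) (by fun_prop) (ae_of_all _ fun x => ?_)
    rw [← Complex.ofReal_mul, Complex.norm_exp_ofReal_mul_I]
  -- Moving the negative part of `q` to the left turns the identity into one between finite positive
  -- measures, where characteristic functions determine the measure.
  have key : ν + γ.withDensity (fun x => ENNReal.ofReal (-q x)) =
      γ.withDensity (fun x => ENNReal.ofReal (q x)) := by
    refine Measure.ext_of_charFun (funext fun s => ?_)
    have : charFun (ν + γ.withDensity (fun x => ENNReal.ofReal (-q x))) s =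
        charFun ν s + charFun (γ.withDensity (fun x => ENNReal.ofReal (-q x))) s := by
      simp only [charFun_apply_real]
      refine integral_add_measure ?_ ?_ <;>
      · refine Integrable.of_bound (C := 1) (by fun_prop) (ae_of_all _ fun x => ?_)
        rw [← Complex.ofReal_mul, Complex.norm_exp_ofReal_mul_I]
    rw [this, h, hch (fun x => -q x) hq.neg, hch _ hq,
      ← eq_sub_iff_add_eq,
      ← integral_sub (hI _ hint s) (hI (fun x => -q x) hint.neg s)]
    refine integral_congr_ae (ae_of_all _ fun x => ?_)
    simp only [← mul_sub, ← Complex.ofReal_sub]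
    congr 2
    rcases le_total (q x) 0 with hx | hx
    · rw [max_eq_right hx, max_eq_left (by linarith)]; ring
    · rw [max_eq_left hx, max_eq_right (by linarith)]; ring
  -- The right side of `key` has no mass on `{q < 0}`, so the negative part vanishes: non-negativity
  -- of `q` is a by-product.
  have hz : γ.withDensity (fun x => ENNReal.ofReal (-q x)) = 0 := by
    have h0 : γ.withDensity (fun x => ENNReal.ofReal (q x)) {x | q x < 0} = 0 := by
      rw [withDensity_apply _ (measurableSet_lt hq measurable_const)]
      refine setLIntegral_eq_zero (measurableSet_lt hq measurable_const) fun x hx => ?_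
      simpa using (show q x < 0 from hx).le
    rw [← key, Measure.add_apply, add_eq_zero] at h0
    have h1 := h0.2
    rw [← Measure.measure_univ_eq_zero, withDensity_apply _ .univ, Measure.restrict_univ,
      ← lintegral_add_compl _ (measurableSet_lt hq measurable_const),
      ← withDensity_apply _ (measurableSet_lt hq measurable_const), h1, zero_add]
    refine setLIntegral_eq_zero (measurableSet_lt hq measurable_const).compl fun x hx => ?_
    simpa using hx
  rw [← key, hz, add_zero]

/-! ### Trigonometric polynomials off the real axis. -/

/-- The real trigonometric polynomial with coefficients `a`, `b`. -/
noncomputable def trigR (N : ℕ) (a b : ℕ → ℝ) (t : ℝ) : ℝ :=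
  a 0 + ∑ k ∈ Finset.Icc 1 N, (a k * Real.cos (k * t) + b k * Real.sin (k * t))

/-- The entire extension of `trigR`. -/
noncomputable def trigC (N : ℕ) (a b : ℕ → ℝ) (z : ℂ) : ℂ :=
  a 0 + ∑ k ∈ Finset.Icc 1 N, (a k * Complex.cos (k * z) + b k * Complex.sin (k * z))

lemma trigC_ofReal (N : ℕ) (a b : ℕ → ℝ) (t : ℝ) : trigC N a b t = trigR N a b t := by
  simp [trigC, trigR]

lemma trigC_conj (N : ℕ) (a b : ℕ → ℝ) (z : ℂ) :
    trigC N a b (starRingEnd ℂ z) = starRingEnd ℂ (trigC N a b z) := by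
  simp [trigC, ← Complex.cos_conj, ← Complex.sin_conj]

lemma trigC_mem (N : ℕ) (a b : ℕ → ℝ) : trigC N a b ∈ expSum := by
  have h : trigC N a b = algebraMap ℂ (ℂ → ℂ) (a 0) + ∑ k ∈ Finset.Icc 1 N,
      ((a k : ℂ) • (fun z : ℂ => Complex.cos ((k : ℝ) * z)) +
        (b k : ℂ) • (fun z : ℂ => Complex.sin ((k : ℝ) * z))) := by
    ext z
    simp [trigC, Finset.sum_apply]
  rw [h]
  exact expSum.add_mem (expSum.algebraMap_mem _) (expSum.sum_mem fun k _ =>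
    expSum.add_mem (expSum.smul_mem (cos_mem_expSum k) _) (expSum.smul_mem (sin_mem_expSum k) _))

/-- The derivative of a trigonometric polynomial is a trigonometric polynomial. -/
lemma hasDerivAt_trigR (N : ℕ) (a b : ℕ → ℝ) (t : ℝ) :
    HasDerivAt (trigR N a b) (trigR N (fun k => k * b k) (fun k => -(k * a k)) t) t := by
  unfold trigR
  simp only [Nat.cast_zero, zero_mul, zero_add]
  refine HasDerivAt.const_add _ (HasDerivAt.fun_sum fun k _ => ?_)
  have h1 : HasDerivAt (fun t : ℝ => (k : ℝ) * t) k t := by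
    simpa using (hasDerivAt_id t).const_mul (k : ℝ)
  exact ((h1.cos.const_mul (a k)).add (h1.sin.const_mul (b k))).congr_deriv (by ring)

lemma deriv_trigR (N : ℕ) (a b : ℕ → ℝ) :
    deriv (trigR N a b) = trigR N (fun k => k * b k) (fun k => -(k * a k)) :=
  funext fun t => (hasDerivAt_trigR N a b t).deriv

lemma analyticAt_trigR (N : ℕ) (a b : ℕ → ℝ) (t : ℝ) : AnalyticAt ℝ (trigR N a b) t := by
  unfold trigR
  fun_prop

lemma continuous_trigR (N : ℕ) (a b : ℕ → ℝ) : Continuous (trigR N a b) := by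
  unfold trigR
  fun_prop

lemma abs_mul_cos_add_le (x y θ : ℝ) : |x * Real.cos θ + y * Real.sin θ| ≤ |x| + |y| := by
  refine (abs_add_le _ _).trans ?_
  rw [abs_mul, abs_mul]
  have h1 := mul_le_of_le_one_right (abs_nonneg x) (Real.abs_cos_le_one θ)
  have h2 := mul_le_of_le_one_right (abs_nonneg y) (Real.abs_sin_le_one θ)
  linarith

lemma abs_trigR_le (N : ℕ) (a b : ℕ → ℝ) (t : ℝ) :
    |trigR N a b t| ≤ |a 0| + ∑ k ∈ Finset.Icc 1 N, (|a k| + |b k|) := by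
  refine (abs_add_le _ _).trans (add_le_add_right ?_ _)
  exact (Finset.abs_sum_le_sum_abs _ _).trans
    (Finset.sum_le_sum fun k _ => abs_mul_cos_add_le _ _ _)

lemma trigC_re (N : ℕ) (a b : ℕ → ℝ) (y u : ℝ) :
    (trigC N a b (y + Complex.I * u)).re = a 0 + ∑ k ∈ Finset.Icc 1 N,
      Real.cosh (k * u) * (a k * Real.cos (k * y) + b k * Real.sin (k * y)) := by
  simp only [trigC, Complex.add_re, Complex.ofReal_re, Complex.re_sum]
  congr 1
  refine Finset.sum_congr rfl fun k _ => ?_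
  have h : (k : ℂ) * (y + Complex.I * u) = ((k * y : ℝ) : ℂ) + ((k * u : ℝ) : ℂ) * Complex.I := by
    push_cast; ring
  rw [h, Complex.cos_add_mul_I, Complex.sin_add_mul_I]
  simp only [← Complex.ofReal_cos, ← Complex.ofReal_sin, ← Complex.ofReal_cosh,
    ← Complex.ofReal_sinh, Complex.add_re, Complex.add_im, Complex.sub_re, Complex.sub_im,
    Complex.mul_re, Complex.mul_im, Complex.ofReal_re, Complex.ofReal_im, Complex.I_re,
    Complex.I_im]
  ring

lemma trigC_im (N : ℕ) (a b : ℕ → ℝ) (y u : ℝ) :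
    (trigC N a b (y + Complex.I * u)).im = ∑ k ∈ Finset.Icc 1 N,
      Real.sinh (k * u) * (b k * Real.cos (k * y) + (-a k) * Real.sin (k * y)) := by
  simp only [trigC, Complex.add_im, Complex.ofReal_im, Complex.im_sum, zero_add]
  refine Finset.sum_congr rfl fun k _ => ?_
  have h : (k : ℂ) * (y + Complex.I * u) = ((k * y : ℝ) : ℂ) + ((k * u : ℝ) : ℂ) * Complex.I := by
    push_cast; ring
  rw [h, Complex.cos_add_mul_I, Complex.sin_add_mul_I]
  simp only [← Complex.ofReal_cos, ← Complex.ofReal_sin, ← Complex.ofReal_cosh,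
    ← Complex.ofReal_sinh, Complex.add_re, Complex.add_im, Complex.sub_re, Complex.sub_im,
    Complex.mul_re, Complex.mul_im, Complex.ofReal_re, Complex.ofReal_im, Complex.I_re,
    Complex.I_im]
  ring

lemma abs_exp_sub_taylor_le (x : ℝ) (n : ℕ) :
    |Real.exp x - ∑ m ∈ Finset.range n, x ^ m / m.factorial| ≤ |x| ^ n * Real.exp |x| := by
  have h := Complex.norm_exp_sub_sum_le_norm_mul_exp x n
  rw [Complex.norm_real, Real.norm_eq_abs] at h
  rw [← Real.norm_eq_abs, ← Complex.norm_real]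
  convert! h using 3
  push_cast
  rfl

lemma abs_cosh_sub_le (x : ℝ) : |Real.cosh x - 1 - x ^ 2 / 2| ≤ |x| ^ 4 * Real.exp |x| := by
  have h1 := abs_exp_sub_taylor_le x 4
  have h2 := abs_exp_sub_taylor_le (-x) 4
  simp only [Finset.sum_range_succ, Finset.sum_range_zero, abs_neg, Nat.factorial] at h1 h2
  rw [Real.cosh_eq]
  rw [abs_le] at *
  norm_num at h1 h2 ⊢
  constructor <;> linarith [h1.1, h1.2, h2.1, h2.2]

lemma abs_sinh_sub_le (x : ℝ) : |Real.sinh x - x| ≤ |x| ^ 2 * Real.exp |x| := by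
  have h1 := abs_exp_sub_taylor_le x 2
  have h2 := abs_exp_sub_taylor_le (-x) 2
  simp only [Finset.sum_range_succ, Finset.sum_range_zero, abs_neg, Nat.factorial] at h1 h2
  rw [Real.sinh_eq]
  rw [abs_le] at *
  norm_num at h1 h2 ⊢
  constructor <;> linarith [h1.1, h1.2, h2.1, h2.2]

lemma abs_cosh_le (x : ℝ) : |Real.cosh x| ≤ Real.exp |x| := by
  rw [← Real.cosh_abs, abs_of_pos (Real.cosh_pos _), Real.cosh_eq]
  linarith [Real.exp_le_exp.2 (neg_le_self (abs_nonneg x))]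

lemma abs_sinh_le (x : ℝ) : |Real.sinh x| ≤ Real.exp |x| := by
  rw [Real.abs_sinh, Real.sinh_eq]
  linarith [Real.exp_pos (-|x|), Real.exp_pos |x|]

/-- A weighted sum of trigonometric monomials is bounded by the coefficients. -/
lemma abs_sum_weight_le {N : ℕ} (a b : ℕ → ℝ) (w θ : ℕ → ℝ) {B : ℝ}
    (hw : ∀ k ∈ Finset.Icc 1 N, |w k| ≤ B) :
    |∑ k ∈ Finset.Icc 1 N, w k * (a k * Real.cos (θ k) + b k * Real.sin (θ k))| ≤
      B * ∑ k ∈ Finset.Icc 1 N, (|a k| + |b k|) := by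
  rw [Finset.mul_sum]
  refine (Finset.abs_sum_le_sum_abs _ _).trans (Finset.sum_le_sum fun k hk => ?_)
  rw [abs_mul]
  exact mul_le_mul (hw k hk) (abs_mul_cos_add_le _ _ _) (abs_nonneg _)
    ((abs_nonneg _).trans (hw k hk))

lemma abs_natCast_mul_le {N k : ℕ} (hk : k ∈ Finset.Icc 1 N) (u : ℝ) : |(k : ℝ) * u| ≤ N * |u| := by
  rw [abs_mul, Nat.abs_cast]
  have : (k : ℝ) ≤ N := by exact_mod_cast (Finset.mem_Icc.1 hk).2
  gcongr

/-- Harmonic `k` is weighted by `cosh (k u)` in the real part, and its quadratic term `k²u²/2`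
reproduces `-u²P''/2`. -/
lemma abs_trigC_re_sub_le (N : ℕ) (a b : ℕ → ℝ) (y u : ℝ) (hu : |u| ≤ 1) :
    |(trigC N a b (y + Complex.I * u)).re - trigR N a b y +
      u ^ 2 / 2 * deriv (deriv (trigR N a b)) y| ≤
      ((N : ℝ) ^ 4 * Real.exp N * ∑ k ∈ Finset.Icc 1 N, (|a k| + |b k|)) * u ^ 4 := by
  have h : (trigC N a b (y + Complex.I * u)).re - trigR N a b y +
      u ^ 2 / 2 * deriv (deriv (trigR N a b)) y = ∑ k ∈ Finset.Icc 1 N,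
        (Real.cosh (k * u) - 1 - (k * u) ^ 2 / 2) *
          (a k * Real.cos (k * y) + b k * Real.sin (k * y)) := by
    rw [trigC_re, deriv_trigR, deriv_trigR]
    simp only [trigR, Nat.cast_zero, zero_mul, zero_add, Finset.mul_sum]
    rw [add_sub_add_left_eq_sub, ← Finset.sum_sub_distrib, ← Finset.sum_add_distrib]
    exact Finset.sum_congr rfl fun k _ => by ring
  rw [h]
  refine (abs_sum_weight_le (B := (N : ℝ) ^ 4 * Real.exp N * u ^ 4) a b _ _ fun k hk => ?_).trans
    (le_of_eq (by ring))
  have h1 := abs_natCast_mul_le hk u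
  refine (abs_cosh_sub_le _).trans ?_
  have h2 : |(k : ℝ) * u| ^ 4 ≤ (N : ℝ) ^ 4 * u ^ 4 := by
    rw [← Even.pow_abs (by decide) u, ← mul_pow]
    gcongr
  have h3 : Real.exp |(k : ℝ) * u| ≤ Real.exp N :=
    Real.exp_le_exp.2 (h1.trans (mul_le_of_le_one_right (Nat.cast_nonneg N) hu))
  calc _ ≤ (N : ℝ) ^ 4 * u ^ 4 * Real.exp N := by gcongr
    _ = _ := by ring

lemma abs_trigC_im_sub_le (N : ℕ) (a b : ℕ → ℝ) (y u : ℝ) (hu : |u| ≤ 1) :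
    |(trigC N a b (y + Complex.I * u)).im - u * deriv (trigR N a b) y| ≤
      ((N : ℝ) ^ 2 * Real.exp N * ∑ k ∈ Finset.Icc 1 N, (|a k| + |b k|)) * u ^ 2 := by
  have h : (trigC N a b (y + Complex.I * u)).im - u * deriv (trigR N a b) y =
      ∑ k ∈ Finset.Icc 1 N, (Real.sinh (k * u) - k * u) *
          (b k * Real.cos (k * y) + (-a k) * Real.sin (k * y)) := by
    rw [trigC_im, deriv_trigR]
    simp only [trigR, Nat.cast_zero, zero_mul, zero_add, Finset.mul_sum]
    rw [← Finset.sum_sub_distrib]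
    exact Finset.sum_congr rfl fun k _ => by ring
  rw [h]
  refine (abs_sum_weight_le (B := (N : ℝ) ^ 2 * Real.exp N * u ^ 2) b (fun k => -a k) _ _
    fun k hk => ?_).trans (le_of_eq (by simp only [abs_neg, add_comm |b _|]; ring))
  have h1 := abs_natCast_mul_le hk u
  refine (abs_sinh_sub_le _).trans ?_
  have h2 : |(k : ℝ) * u| ^ 2 ≤ (N : ℝ) ^ 2 * u ^ 2 := by
    rw [← Even.pow_abs (by decide) u, ← mul_pow]
    gcongr
  have h3 : Real.exp |(k : ℝ) * u| ≤ Real.exp N :=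
    Real.exp_le_exp.2 (h1.trans (mul_le_of_le_one_right (Nat.cast_nonneg N) hu))
  calc _ ≤ (N : ℝ) ^ 2 * u ^ 2 * Real.exp N := by gcongr
    _ = _ := by ring

lemma norm_trigC_le (N : ℕ) (a b : ℕ → ℝ) (y u : ℝ) :
    ‖trigC N a b (y + Complex.I * u)‖ ≤
      (|a 0| + 2 * ∑ k ∈ Finset.Icc 1 N, (|a k| + |b k|)) * Real.exp (N * |u|) := by
  refine (Complex.norm_le_abs_re_add_abs_im _).trans ?_
  rw [trigC_re, trigC_im]
  have h1 := abs_sum_weight_le (N := N) (B := Real.exp (N * |u|)) a b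
    (fun k => Real.cosh (k * u)) (fun k => k * y) fun k hk =>
      (abs_cosh_le _).trans (Real.exp_le_exp.2 (abs_natCast_mul_le hk u))
  have h2 := abs_sum_weight_le (N := N) (B := Real.exp (N * |u|)) b (fun k => -a k)
    (fun k => Real.sinh (k * u)) (fun k => k * y) fun k hk =>
      (abs_sinh_le _).trans (Real.exp_le_exp.2 (abs_natCast_mul_le hk u))
  simp only [abs_neg, add_comm |b _|] at h2
  have h3 : |a 0| ≤ |a 0| * Real.exp (N * |u|) :=
    le_mul_of_one_le_right (abs_nonneg _) (Real.one_le_exp (by positivity))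
  have h4 := abs_add_le (a 0) (∑ k ∈ Finset.Icc 1 N,
      Real.cosh (k * u) * (a k * Real.cos (k * y) + b k * Real.sin (k * y)))
  linarith

/-! ### Domination of squared derivatives. -/

/-- A non-negative analytic function vanishing to third order at a point vanishes to fourth order,
and near this point it dominates the squares of its first two derivatives. -/
lemma eventually_deriv_sq_le {P : ℝ → ℝ} (hP : AnalyticAt ℝ P 0) (hnn : ∀ᶠ t in 𝓝 0, 0 ≤ P t)
    (hne : ¬ ∀ᶠ t in 𝓝 0, P t = 0)
    (h0 : P 0 = 0) (h1 : deriv P 0 = 0) (h2 : deriv (deriv P) 0 = 0) :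
    ∃ K : ℝ, ∀ᶠ t in 𝓝 0, deriv P t ^ 2 ≤ K * P t ∧ deriv (deriv P) t ^ 2 ≤ K * P t := by
  obtain ⟨n, g, hg, hg0, hPg⟩ := hP.exists_eventuallyEq_pow_smul_nonzero_iff.2 hne
  simp only [sub_zero, smul_eq_mul] at hPg
  have hord : analyticOrderAt P 0 = n := (hP.analyticOrderAt_eq_natCast).2
    ⟨g, hg, hg0, by simpa using hPg⟩
  have h3 : 3 ≤ n := by
    have : ((3 : ℕ) : ℕ∞) ≤ analyticOrderAt P 0 := by
      rw [natCast_le_analyticOrderAt_iff_iteratedDeriv_eq_zero hP]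
      intro i hi
      interval_cases i
      · simpa using h0
      · simpa using h1
      · simpa [iteratedDeriv_succ] using h2
    rw [hord] at this
    exact_mod_cast this
  obtain ⟨m, rfl⟩ := Nat.exists_eq_add_of_le' h3
  have hd1 : analyticOrderAt (deriv P) 0 = (m + 2 : ℕ) :=
    analyticOrderAt_deriv_of_pos hP (by rw [hord]; push_cast; ring)
  have hd2 : analyticOrderAt (deriv (deriv P)) 0 = (m + 1 : ℕ) :=
    analyticOrderAt_deriv_of_pos hP.deriv (by rw [hd1]; push_cast; ring)
  obtain ⟨g1, hg1, -, hPg1⟩ := (hP.deriv.analyticOrderAt_eq_natCast).1 hd1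
  obtain ⟨g2, hg2, -, hPg2⟩ := (hP.deriv.deriv.analyticOrderAt_eq_natCast).1 hd2
  simp only [sub_zero, smul_eq_mul] at hPg1 hPg2
  -- The order is `m + 3`; order exactly 3 would force a change of sign at 0.
  have hm : m ≠ 0 := by
    rintro rfl
    have hr : ∀ᶠ t in 𝓝[>] (0 : ℝ), 0 ≤ g t := by
      filter_upwards [hnn.filter_mono nhdsWithin_le_nhds, hPg.filter_mono nhdsWithin_le_nhds,
        self_mem_nhdsWithin] with t ht1 ht2 (ht3 : 0 < t)
      rw [ht2] at ht1
      exact nonneg_of_mul_nonneg_right ht1 (by positivity)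
    have hl : ∀ᶠ t in 𝓝[<] (0 : ℝ), g t ≤ 0 := by
      filter_upwards [hnn.filter_mono nhdsWithin_le_nhds, hPg.filter_mono nhdsWithin_le_nhds,
        self_mem_nhdsWithin] with t ht1 ht2 (ht3 : t < 0)
      rw [ht2] at ht1
      exact nonpos_of_mul_nonneg_right ht1 (Odd.pow_neg (by decide) ht3)
    have hc := hg.continuousAt.tendsto
    exact hg0 (le_antisymm (le_of_tendsto (hc.mono_left nhdsWithin_le_nhds) hl)
      (ge_of_tendsto (hc.mono_left nhdsWithin_le_nhds) hr))
  obtain ⟨j, rfl⟩ := Nat.exists_eq_succ_of_ne_zero hm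
  have key (G : ℝ → ℝ) (hG : AnalyticAt ℝ G 0) :
      ∀ᶠ t in 𝓝 0, G t ^ 2 ≤ ((G 0 ^ 2 + 1) / (|g 0| / 2)) * |g t| := by
    have e1 : ∀ᶠ t in 𝓝 0, G t ^ 2 < G 0 ^ 2 + 1 :=
      (hG.continuousAt.pow 2).eventually_lt_const (by simp)
    have hgp : 0 < |g 0| := abs_pos.2 hg0
    have e2 : ∀ᶠ t in 𝓝 0, |g 0| / 2 < |g t| :=
      (hg.continuousAt.abs).eventually_const_lt (by simpa using hgp)
    filter_upwards [e1, e2] with t h1 h2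
    rw [div_mul_eq_mul_div, le_div_iff₀ (by positivity)]
    exact mul_le_mul h1.le h2.le (by positivity) (by positivity)
  have hsmall : ∀ᶠ t : ℝ in 𝓝 0, |t| ≤ 1 := by
    filter_upwards [Metric.closedBall_mem_nhds (0 : ℝ) one_pos] with t ht
    simpa using ht
  refine ⟨max ((g1 0 ^ 2 + 1) / (|g 0| / 2)) ((g2 0 ^ 2 + 1) / (|g 0| / 2)), ?_⟩
  filter_upwards [hnn, hPg, hPg1, hPg2, key g1 hg1, key g2 hg2, hsmall] with t ht hp hp1 hp2 k1 k2 hs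
  have hPa : P t = |t| ^ (j + 4) * |g t| := by
    rw [← abs_of_nonneg ht, hp, abs_mul, abs_pow]
  rw [hp1, hp2, hPa]
  have hK := le_max_left ((g1 0 ^ 2 + 1) / (|g 0| / 2)) ((g2 0 ^ 2 + 1) / (|g 0| / 2))
  have hK' := le_max_right ((g1 0 ^ 2 + 1) / (|g 0| / 2)) ((g2 0 ^ 2 + 1) / (|g 0| / 2))
  -- With `P` of order `n = j + 4`, the squares have orders `2(n-1)` and `2(n-2)`; the latter is at
  -- least `n` exactly when `n ≥ 4`.
  have p1 : (t ^ (j + 1 + 2)) ^ 2 ≤ |t| ^ (j + 4) := by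
    rw [← sq_abs, abs_pow, ← pow_mul]
    exact pow_le_pow_of_le_one (abs_nonneg t) hs (by omega)
  have p2 : (t ^ (j + 1 + 1)) ^ 2 ≤ |t| ^ (j + 4) := by
    rw [← sq_abs, abs_pow, ← pow_mul]
    exact pow_le_pow_of_le_one (abs_nonneg t) hs (by omega)
  rw [mul_pow, mul_pow, mul_left_comm]
  constructor
  · exact mul_le_mul p1 (k1.trans (by gcongr)) (by positivity) (by positivity)
  · exact mul_le_mul p2 (k2.trans (by gcongr)) (by positivity) (by positivity)

/-- A continuous periodic function bounded locally by multiples of a non-negative function is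
bounded by a multiple of it. -/
lemma exists_le_mul_of_locally {P F : ℝ → ℝ} {h : ℝ} (hh : 0 < h) (hP : Function.Periodic P h)
    (hF : Function.Periodic F h) (hnn : ∀ t, 0 ≤ P t)
    (hloc : ∀ t ∈ Set.Icc 0 h, ∃ K, ∀ᶠ s in 𝓝 t, F s ≤ K * P s) :
    ∃ K, ∀ t, F t ≤ K * P t := by
  have : ∃ K, ∀ t ∈ Set.Icc 0 h, F t ≤ K * P t := by
    refine isCompact_Icc.induction_on (p := fun s => ∃ K, ∀ t ∈ s, F t ≤ K * P t) ⟨0, by simp⟩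
      (fun s t hst ⟨K, hK⟩ => ⟨K, fun x hx => hK x (hst hx)⟩) ?_ ?_
    · rintro s t ⟨K, hK⟩ ⟨K', hK'⟩
      refine ⟨max K K', fun x hx => ?_⟩
      rcases hx with hx | hx
      · exact (hK x hx).trans (mul_le_mul_of_nonneg_right (le_max_left _ _) (hnn x))
      · exact (hK' x hx).trans (mul_le_mul_of_nonneg_right (le_max_right _ _) (hnn x))
    · intro t ht
      obtain ⟨K, hK⟩ := hloc t ht
      exact ⟨_, mem_nhdsWithin_of_mem_nhds hK, K, fun x hx => hx⟩
  obtain ⟨K, hK⟩ := this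
  refine ⟨K, fun t => ?_⟩
  -- Pairing the functions reduces both to the same point of one period.
  have hPF : Function.Periodic (fun t => (P t, F t)) h := fun t => by simp only [hP t, hF t]
  obtain ⟨y, hy, hPy⟩ := hPF.exists_mem_Ico₀ hh t
  simp only [Prod.mk.injEq] at hPy
  rw [hPy.1, hPy.2]
  exact hK y ⟨hy.1, hy.2.le⟩

lemma periodic_deriv {P : ℝ → ℝ} {h : ℝ} (hP : Function.Periodic P h) :
    Function.Periodic (deriv P) h := by
  intro t
  rw [← deriv_comp_add_const, show (fun x => P (x + h)) = P from funext hP]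

/-- By compactness of a period only the zeros of `P` matter, and strict positivity leaves just the
endpoints. At a zero of order two the bound on `P''²` would fail. -/
lemma exists_deriv_sq_le {P : ℝ → ℝ} {h : ℝ} (hh : 0 < h) (hper : Function.Periodic P h)
    (hP : ∀ t, AnalyticAt ℝ P t) (hpos : ∀ t, 0 < t → t < h → 0 < P t)
    (h0 : P 0 = 0) (h1 : deriv P 0 = 0) (h2 : deriv (deriv P) 0 = 0) :
    ∃ K : ℝ, 0 < K ∧ ∀ t, deriv P t ^ 2 ≤ K * P t ∧ deriv (deriv P) t ^ 2 ≤ K * P t := by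
  have hnn : ∀ t, 0 ≤ P t := by
    intro t
    obtain ⟨y, hy, hPy⟩ := hper.exists_mem_Ico₀ hh t
    rw [hPy]
    rcases hy.1.eq_or_lt with rfl | hy0
    · exact h0.ge
    · exact (hpos y hy0 hy.2).le
  have hne : ¬ ∀ᶠ t in 𝓝 0, P t = 0 := by
    intro hz
    have hz' : ∀ᶠ t in 𝓝[>] (0 : ℝ), P t = 0 := hz.filter_mono nhdsWithin_le_nhds
    obtain ⟨t, ht, ht'⟩ := (hz'.and (Ioo_mem_nhdsGT hh)).exists
    exact (hpos t ht'.1 ht'.2).ne' ht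
  obtain ⟨K, hK⟩ := eventually_deriv_sq_le (hP 0) (Eventually.of_forall hnn) hne h0 h1 h2
  have hp1 := periodic_deriv hper
  have hp2 := periodic_deriv hp1
  obtain ⟨K, hK⟩ := exists_le_mul_of_locally
    (F := fun t => max (deriv P t ^ 2) (deriv (deriv P) t ^ 2)) hh hper
    (fun t => by simp only [hp1 t, hp2 t]) hnn (by
      intro t ht
      rcases ht.1.eq_or_lt with rfl | ht0
      · exact ⟨K, hK.mono fun s hs => max_le hs.1 hs.2⟩
      rcases ht.2.eq_or_lt with rfl | hth
      · refine ⟨K, ?_⟩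
        have ht : Tendsto (fun s => s - t) (𝓝 t) (𝓝 0) := by
          have : ContinuousAt (fun s : ℝ => s - t) t := by fun_prop
          simpa [ContinuousAt] using this
        refine (ht.eventually hK).mono fun s hs => ?_
        rw [hper.sub_eq, hp1.sub_eq, hp2.sub_eq] at hs
        exact max_le hs.1 hs.2
      · have hc : ContinuousAt (fun s => max (deriv P s ^ 2) (deriv (deriv P) s ^ 2)) t :=
          ((hP t).deriv.continuousAt.pow 2).max ((hP t).deriv.deriv.continuousAt.pow 2)
        have hpt := hpos t ht0 hth
        set M := max (deriv P t ^ 2) (deriv (deriv P) t ^ 2) with hM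
        have hM0 : 0 ≤ M := (sq_nonneg _).trans (le_max_left _ _)
        refine ⟨(M + 1) / (P t / 2), ?_⟩
        filter_upwards [hc.eventually_lt_const (lt_add_one M),
          (hP t).continuousAt.eventually_const_lt (half_lt_self hpt)] with s hs1 hs2
        rw [div_mul_eq_mul_div, le_div_iff₀ (by positivity)]
        exact mul_le_mul hs1.le hs2.le (by positivity) (by positivity))
  refine ⟨max K 1, by positivity, fun t => ?_⟩
  have h3 : K * P t ≤ max K 1 * P t := mul_le_mul_of_nonneg_right (le_max_left _ _) (hnn t)
  exact ⟨((le_max_left _ _).trans (hK t)).trans h3, ((le_max_right _ _).trans (hK t)).trans h3⟩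

/-! ### Bounds for the multiplier on horizontal lines. -/

/-- Here `R`, `J` stand for the real and imaginary parts of `P(y + iu)`. Expanding gives `1 + c(-2R
+ c(R² + J²))`; of the `-2p` in `-2R`, one `p` pays for the quadratic part and the other for
`u²P''`. -/
lemma sq_estimate {p p1 p2 R J u c A K C : ℝ} (hp : 0 ≤ p) (hpA : p ≤ A) (hK : 0 < K)
    (h1 : p1 ^ 2 ≤ K * p) (h2 : p2 ^ 2 ≤ K * p) (hu : |u| ≤ 1)
    (hR : |R - p + u ^ 2 / 2 * p2| ≤ C * u ^ 4) (hJ : |J - u * p1| ≤ C * u ^ 2)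
    (hc : 0 < c) (hc1 : c ≤ 1) (hcA : c * (3 * A + 3 * K) ≤ 1) :
    (1 - c * R) ^ 2 + (c * J) ^ 2 ≤ 1 + c * ((K / 4 + 2 * C + 5 * C ^ 2) * u ^ 4) := by
  have hu2 : u ^ 2 ≤ 1 := by rw [← sq_abs]; exact pow_le_one₀ (abs_nonneg u) hu
  have hu4 : u ^ 4 ≤ 1 := by nlinarith [sq_nonneg u]
  have hu4' : 0 ≤ u ^ 4 := by positivity
  obtain ⟨e, he⟩ : ∃ e, e = R - p + u ^ 2 / 2 * p2 := ⟨_, rfl⟩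
  obtain ⟨d, hd⟩ : ∃ d, d = J - u * p1 := ⟨_, rfl⟩
  rw [← he] at hR
  rw [← hd] at hJ
  have he2 : e ^ 2 ≤ C ^ 2 * u ^ 4 := by
    rw [← sq_abs e]
    calc |e| ^ 2 ≤ (C * u ^ 4) ^ 2 := by gcongr
      _ = C ^ 2 * u ^ 4 * u ^ 4 := by ring
      _ ≤ C ^ 2 * u ^ 4 * 1 := by gcongr
      _ = _ := by ring
  have hd2 : d ^ 2 ≤ C ^ 2 * u ^ 4 := by
    rw [← sq_abs d]
    calc |d| ^ 2 ≤ (C * u ^ 2) ^ 2 := by gcongr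
      _ = _ := by ring
  have hRe : R = p - u ^ 2 / 2 * p2 + e := by rw [he]; ring
  have hJe : J = u * p1 + d := by rw [hd]; ring
  have hq : u ^ 4 * p2 ^ 2 ≤ K * p :=
    (mul_le_of_le_one_left (sq_nonneg _) hu4).trans h2
  have hq1 : u ^ 2 * p1 ^ 2 ≤ K * p :=
    (mul_le_of_le_one_left (sq_nonneg _) hu2).trans h1
  have hpp : p ^ 2 ≤ A * p := by rw [sq]; gcongr
  have hRsq : R ^ 2 ≤ 3 * p ^ 2 + 3 / 4 * (u ^ 4 * p2 ^ 2) + 3 * e ^ 2 := by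
    rw [hRe]
    linarith [sq_nonneg (p + u ^ 2 / 2 * p2), sq_nonneg (p - e), sq_nonneg (u ^ 2 / 2 * p2 + e)]
  have hJsq : J ^ 2 ≤ 2 * (u ^ 2 * p1 ^ 2) + 2 * d ^ 2 := by
    rw [hJe]
    linarith [sq_nonneg (u * p1 - d)]
  have hsum : R ^ 2 + J ^ 2 ≤ (3 * A + 3 * K) * p + 5 * (C ^ 2 * u ^ 4) := by
    linarith [mul_nonneg hK.le hp]
  have hsum2 : c * (R ^ 2 + J ^ 2) ≤ p + 5 * (C ^ 2 * u ^ 4) := by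
    have h3 : c * (5 * (C ^ 2 * u ^ 4)) ≤ 1 * (5 * (C ^ 2 * u ^ 4)) := by gcongr
    have h4 : c * (3 * A + 3 * K) * p ≤ 1 * p := by gcongr
    have h5 := mul_le_mul_of_nonneg_left hsum hc.le
    linarith
  have hcross : u ^ 2 * p2 ≤ p + K / 4 * u ^ 4 := by
    have h5 : 0 ≤ (p2 - K / 2 * u ^ 2) ^ 2 := sq_nonneg _
    have h6 : K * (u ^ 2 * p2) ≤ K * (p + K / 4 * u ^ 4) := by linarith
    exact le_of_mul_le_mul_left h6 hK
  have hfin : -2 * R + c * (R ^ 2 + J ^ 2) ≤ (K / 4 + 2 * C + 5 * C ^ 2) * u ^ 4 := by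
    have := (abs_le.1 hR).1
    linarith
  linarith [mul_le_mul_of_nonneg_left hfin hc.le]

/-- For small `c`, the entire extension of `1 - c P` is bounded by `exp (u² / 4)` on the lines
`Im z = u`, and by `exp (O (u⁴))` for `|u| ≤ 1`. -/
lemma exists_norm_one_sub_le {N : ℕ} {a b : ℕ → ℝ} {h : ℝ} (hh : 0 < h)
    (hper : Function.Periodic (trigR N a b) h) (hpos : ∀ t, 0 < t → t < h → 0 < trigR N a b t)
    (h0 : trigR N a b 0 = 0) (h1 : deriv (trigR N a b) 0 = 0)
    (h2 : deriv (deriv (trigR N a b)) 0 = 0) :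
    ∃ c₁ : ℝ, 0 < c₁ ∧ ∃ D : ℝ, ∀ c : ℝ, 0 < c → c < c₁ → ∀ y u : ℝ,
      ‖1 - c * trigC N a b (y + Complex.I * u)‖ ≤ Real.exp (u ^ 2 / 4) ∧
      (|u| ≤ 1 → ‖1 - c * trigC N a b (y + Complex.I * u)‖ ≤ Real.exp (D * u ^ 4)) := by
  obtain ⟨K, hK, hKP⟩ := exists_deriv_sq_le hh hper (analyticAt_trigR N a b) hpos h0 h1 h2
  have hnn : ∀ t, 0 ≤ trigR N a b t := fun t =>
    nonneg_of_mul_nonneg_right ((sq_nonneg _).trans (hKP t).1) hK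
  obtain ⟨S, hS⟩ : ∃ S, S = ∑ k ∈ Finset.Icc 1 N, (|a k| + |b k|) := ⟨_, rfl⟩
  have hS0 : 0 ≤ S := by rw [hS]; positivity
  obtain ⟨A, hA⟩ : ∃ A, A = |a 0| + S := ⟨_, rfl⟩
  have hA0 : 0 ≤ A := by rw [hA]; positivity
  obtain ⟨C, hC⟩ : ∃ C, C = (N : ℝ) ^ 4 * Real.exp N * S + (N : ℝ) ^ 2 * Real.exp N * S := ⟨_, rfl⟩
  have hC0 : 0 ≤ C := by rw [hC]; positivity
  obtain ⟨D, hD⟩ : ∃ D, D = K / 4 + 2 * C + 5 * C ^ 2 := ⟨_, rfl⟩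
  have hD0 : 0 < D := by rw [hD]; positivity
  obtain ⟨E, hE⟩ : ∃ E, E = (|a 0| + 2 * S) * Real.exp (2 * N ^ 2) := ⟨_, rfl⟩
  have hE0 : 0 ≤ E := by rw [hE]; positivity
  have hsq (c : ℝ) (hc : 0 < c) (hc1 : c ≤ 1) (hcA : c * (3 * A + 3 * K) ≤ 1) (y u : ℝ)
      (hu : |u| ≤ 1) : ‖1 - c * trigC N a b (y + Complex.I * u)‖ ≤
        Real.exp (c * D / 2 * u ^ 4) := by
    have hA' : trigR N a b y ≤ A := by
      rw [hA, hS]; exact (le_abs_self _).trans (abs_trigR_le N a b y)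
    have hR := abs_trigC_re_sub_le N a b y u hu
    have hJ := abs_trigC_im_sub_le N a b y u hu
    rw [← hS] at hR hJ
    have key := sq_estimate (C := C) (hnn y) hA' hK (hKP y).1 (hKP y).2 hu
      (hR.trans (by rw [hC]; gcongr; simp; positivity))
      (hJ.trans (by rw [hC]; gcongr; simp; positivity)) hc hc1 hcA
    rw [← hD] at key
    have hn : ‖1 - c * trigC N a b (y + Complex.I * u)‖ ^ 2 =
        (1 - c * (trigC N a b (y + Complex.I * u)).re) ^ 2 +
          (c * (trigC N a b (y + Complex.I * u)).im) ^ 2 := by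
      rw [← Complex.normSq_eq_norm_sq, Complex.normSq_apply]
      simp
      ring
    rw [← hn] at key
    refine le_of_sq_le_sq ?_ (Real.exp_pos _).le
    rw [← Real.exp_nat_mul]
    refine key.trans ?_
    have := Real.add_one_le_exp (c * (D * u ^ 4))
    rw [show ((2 : ℕ) : ℝ) * (c * D / 2 * u ^ 4) = c * (D * u ^ 4) by push_cast; ring]
    linarith
  -- The first two bounds on `c` serve `sq_estimate`, the third makes `cDu⁴/2 ≤ u²/4` for `|u| ≤ 1`,
  -- the fourth makes `cE ≤ 1/8` for `|u| ≥ 1`.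
  refine ⟨min (min 1 (1 / (3 * A + 3 * K))) (min (1 / (2 * D)) (1 / (8 * (E + 1)))), by positivity,
    D / 2, fun c hc hcc y u => ?_⟩
  simp only [lt_min_iff] at hcc
  obtain ⟨⟨hc1, hcA⟩, hcD, hcE⟩ := hcc
  rw [lt_div_iff₀ (by positivity)] at hcA hcD hcE
  have hs := hsq c hc hc1.le hcA.le y u
  constructor
  · rcases le_total |u| 1 with hu | hu
    · refine (hs hu).trans (Real.exp_le_exp.2 ?_)
      have hu2 : u ^ 2 ≤ 1 := by rw [← sq_abs]; exact pow_le_one₀ (abs_nonneg u) hu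
      have : c * D / 2 * u ^ 2 ≤ 1 / 4 * 1 := by
        refine mul_le_mul (by linarith) hu2 (by positivity) (by norm_num)
      nlinarith [sq_nonneg u]
    · have hT := norm_trigC_le N a b y u
      rw [← hS] at hT
      obtain ⟨w, hw⟩ : ∃ w, w = Real.exp (u ^ 2 / 8) := ⟨_, rfl⟩
      have hw1 : 9 / 8 ≤ w := by
        have h3 := Real.add_one_le_exp (u ^ 2 / 8)
        have h4 : 1 ≤ u ^ 2 := by rw [← sq_abs]; exact one_le_pow₀ hu
        rw [hw]; linarith
      -- Completing the square gives `N|u| ≤ 2N² + u²/8`, the source of the factor in `E`.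
      have hew : Real.exp (N * |u|) ≤ Real.exp (2 * N ^ 2) * w := by
        rw [hw, ← Real.exp_add, Real.exp_le_exp, ← sq_abs u]
        nlinarith [sq_nonneg ((4 * N : ℝ) - |u|)]
      have hT2 : ‖trigC N a b (y + Complex.I * u)‖ ≤ E * w := by
        refine hT.trans ?_
        rw [hE, mul_assoc]
        gcongr
      have hw2 : Real.exp (u ^ 2 / 4) = w ^ 2 := by
        rw [hw, ← Real.exp_nat_mul]; congr 1; push_cast; ring
      rw [hw2]
      calc ‖1 - c * trigC N a b (y + Complex.I * u)‖
          ≤ ‖(1 : ℂ)‖ + ‖c * trigC N a b (y + Complex.I * u)‖ := norm_sub_le _ _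
        _ ≤ 1 + c * (E * w) := by
          rw [norm_mul, Complex.norm_real, Real.norm_of_nonneg hc.le, norm_one]
          gcongr
        _ ≤ 1 + 1 / 8 * w := by
          have : c * E ≤ 1 / 8 := by nlinarith
          nlinarith
        _ ≤ w ^ 2 := by nlinarith
  · intro hu
    refine (hs hu).trans (Real.exp_le_exp.2 ?_)
    have : c * D / 2 ≤ D / 2 := by nlinarith
    gcongr

/-! ### The normal density and the Tsallis distance. -/

lemma stdNormalDensity_eq (x : ℝ) : stdNormalDensity x = gaussianPDFReal 0 1 x := by
  simp [stdNormalDensity, gaussianPDFReal]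

lemma stdNormalDensity_pos (x : ℝ) : 0 < stdNormalDensity x := by
  rw [stdNormalDensity_eq]
  exact gaussianPDFReal_pos 0 1 x one_ne_zero

lemma measurable_stdNormalDensity : Measurable stdNormalDensity := by
  unfold stdNormalDensity
  fun_prop

lemma integrable_stdNormalDensity : Integrable stdNormalDensity := by
  rw [funext stdNormalDensity_eq]
  exact integrable_gaussianPDFReal 0 1

lemma integral_stdNormalDensity : ∫ x, stdNormalDensity x = 1 := by
  rw [funext stdNormalDensity_eq]
  exact integral_gaussianPDFReal_eq_one 0 one_ne_zero

lemma gaussian_withDensity {q : ℝ → ℝ} (hq : Measurable q) :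
    (gaussianReal 0 1).withDensity (fun x => ENNReal.ofReal (q x)) =
      volume.withDensity (fun x => ENNReal.ofReal (max (q x) 0 * stdNormalDensity x)) := by
  rw [gaussianReal_of_var_ne_zero 0 one_ne_zero,
    ← withDensity_mul _ (measurable_gaussianPDF 0 1) (by fun_prop)]
  congr 1
  ext x
  rw [Pi.mul_apply, gaussianPDF, ← stdNormalDensity_eq, mul_comm,
    ENNReal.ofReal_mul (le_max_right _ _)]
  simp

lemma isDensity_gaussian_withDensity {q : ℝ → ℝ} (hq : Measurable q) :
    IsDensity (fun x => max (q x) 0 * stdNormalDensity x)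
      ((gaussianReal 0 1).withDensity (fun x => ENNReal.ofReal (q x))) where
  measurable := (hq.max measurable_const).mul measurable_stdNormalDensity
  nonneg x := mul_nonneg (le_max_right _ _) (stdNormalDensity_pos x).le
  eq_withDensity := gaussian_withDensity hq

/-- A negative essential supremum would put `p` strictly below `φ` almost everywhere, although both
integrate to 1. -/
lemma tsallisInfty_nonneg {p : ℝ → ℝ} {ν : Measure ℝ} [IsProbabilityMeasure ν]
    (hp : IsDensity p ν) : 0 ≤ tsallisInfty p := by
  by_contra! hlt
  have hae : ∀ᵐ x, p x < stdNormalDensity x := by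
    filter_upwards [ae_lt_of_essSup_lt hlt] with x hx
    have hx' : (p x - stdNormalDensity x) / stdNormalDensity x < 0 := by exact_mod_cast hx
    rw [div_neg_iff] at hx'
    have := stdNormalDensity_pos x
    rcases hx' with h | h <;> linarith [h.1, h.2]
  have hpi : Integrable p := by
    refine integrable_stdNormalDensity.mono' hp.measurable.aestronglyMeasurable ?_
    filter_upwards [hae] with x hx
    rw [Real.norm_of_nonneg (hp.nonneg x)]
    exact hx.le
  have h1 : ∫ x, p x = 1 := by
    rw [integral_eq_lintegral_of_nonneg_ae (ae_of_all _ hp.nonneg)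
      hp.measurable.aestronglyMeasurable]
    have : ∫⁻ x, ENNReal.ofReal (p x) = ν Set.univ := by
      rw [hp.eq_withDensity, withDensity_apply _ .univ, Measure.restrict_univ]
    rw [this]
    simp
  have h2 : ∫ x, (stdNormalDensity x - p x) = 0 := by
    rw [integral_sub integrable_stdNormalDensity hpi, h1, integral_stdNormalDensity, sub_self]
  rw [integral_eq_zero_iff_of_nonneg_ae (hae.mono fun x hx => sub_nonneg.2 hx.le)
    (integrable_stdNormalDensity.sub hpi)] at h2
  obtain ⟨x, hx, hx'⟩ := (h2.and hae).exists
  simp only [Pi.zero_apply] at hx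
  linarith

lemma tsallisInfty_le {q : ℝ → ℝ} {B : ℝ} (hq : ∀ x, q x ≤ B) :
    tsallisInfty (fun x => q x * stdNormalDensity x) ≤ ((B - 1 : ℝ) : EReal) := by
  refine essSup_le_of_ae_le _ (ae_of_all _ fun x => ?_)
  have := (stdNormalDensity_pos x).ne'
  have h : (q x * stdNormalDensity x - stdNormalDensity x) / stdNormalDensity x = q x - 1 := by
    field_simp
  simp only [h]
  exact_mod_cast sub_le_sub_right (hq x) 1

/-! ### Multipliers of the normalized sums. -/

/-- Weighting the coefficients of a trigonometric polynomial by `exp (k² / 2)` inverts the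
multiplier of its Laplace transform against the normal density. -/
lemma gaussT_trigC (N : ℕ) (a b : ℕ → ℝ) (x : ℝ) : gaussT (trigC N a b) x =
    trigR N (fun k => Real.exp (k ^ 2 / 2) * a k) (fun k => Real.exp (k ^ 2 / 2) * b k) x := by
  have hcos (l : ℝ) : gaussT (fun z => Complex.cos (l * z)) x =
      Complex.exp (l ^ 2 / 2) * Complex.cos (l * x) := by
    have h : (fun z : ℂ => Complex.cos (l * z)) =
        (1 / 2 : ℂ) • ((fun z => Complex.exp (Complex.I * l * z)) +
          (fun z => Complex.exp (Complex.I * (-l : ℝ) * z))) := by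
      ext z
      simp only [Complex.cos, Pi.smul_apply, Pi.add_apply, smul_eq_mul]
      push_cast
      ring_nf
    rw [h, gaussT_smul, gaussT_add (exp_mem_expSum l) (exp_mem_expSum (-l)), Pi.smul_apply,
      Pi.add_apply, gaussT_exp, gaussT_exp, Complex.cos]
    push_cast
    simp only [smul_eq_mul]
    ring_nf
  have hsin (l : ℝ) : gaussT (fun z => Complex.sin (l * z)) x =
      Complex.exp (l ^ 2 / 2) * Complex.sin (l * x) := by
    have h : (fun z : ℂ => Complex.sin (l * z)) =
        (Complex.I / 2 : ℂ) • ((fun z => Complex.exp (Complex.I * (-l : ℝ) * z)) +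
          (-1 : ℂ) • (fun z => Complex.exp (Complex.I * l * z))) := by
      ext z
      simp only [Complex.sin, Pi.smul_apply, Pi.add_apply, smul_eq_mul]
      push_cast
      ring_nf
    rw [h, gaussT_smul, gaussT_add (exp_mem_expSum (-l)) (expSum.smul_mem (exp_mem_expSum l) _),
      gaussT_smul, Pi.smul_apply, Pi.add_apply, Pi.smul_apply, gaussT_exp, gaussT_exp, Complex.sin]
    push_cast
    simp only [smul_eq_mul]
    ring_nf
  simp only [gaussT] at hcos hsin
  have hi1 (k : ℕ) : Integrable (fun g : ℝ => (a k : ℂ) * Complex.cos (k * (x + Complex.I * g)))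
      (gaussianReal 0 1) := (expSum_integrable (cos_mem_expSum k) x).const_mul _
  have hi2 (k : ℕ) : Integrable (fun g : ℝ => (b k : ℂ) * Complex.sin (k * (x + Complex.I * g)))
      (gaussianReal 0 1) := (expSum_integrable (sin_mem_expSum k) x).const_mul _
  have hi (k : ℕ) : Integrable (fun g : ℝ => (a k : ℂ) * Complex.cos (k * (x + Complex.I * g)) +
      (b k : ℂ) * Complex.sin (k * (x + Complex.I * g))) (gaussianReal 0 1) := (hi1 k).add (hi2 k)
  simp only [gaussT, trigC]
  rw [integral_add (integrable_const _) (integrable_finsetSum _ fun k _ => hi k),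
    integral_finsetSum _ fun k _ => hi k]
  simp only [trigR]
  push_cast
  congr 1
  · simp
  · refine Finset.sum_congr rfl fun k _ => ?_
    have h1 := hcos k
    have h2 := hsin k
    push_cast at h1 h2
    rw [integral_add (hi1 k) (hi2 k), integral_const_mul, integral_const_mul, h1, h2]
    ring

lemma one_sub_trigC_mem (N : ℕ) (a b : ℕ → ℝ) (c : ℝ) :
    (fun z => 1 - c * trigC N a b z) ∈ expSum :=
  expSum.sub_mem expSum.one_mem (expSum.smul_mem (trigC_mem N a b) c)

/-- The entire extension of the multiplier of the normalized sum of `n` copies. -/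
noncomputable def sumMult (N : ℕ) (a b : ℕ → ℝ) (c : ℝ) (n : ℕ) (z : ℂ) : ℂ :=
  (1 - c * trigC N a b (((√(n : ℝ))⁻¹ : ℝ) * z)) ^ n

lemma sumMult_mem (N : ℕ) (a b : ℕ → ℝ) (c : ℝ) (n : ℕ) : sumMult N a b c n ∈ expSum :=
  expSum.pow_mem (expSum_comp_mul (one_sub_trigC_mem N a b c) (√(n : ℝ))⁻¹) n

lemma sumMult_conj (N : ℕ) (a b : ℕ → ℝ) (c : ℝ) (n : ℕ) (z : ℂ) :
    sumMult N a b c n (starRingEnd ℂ z) = starRingEnd ℂ (sumMult N a b c n z) := by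
  simp only [sumMult, map_pow, map_sub, map_mul, map_one, Complex.conj_ofReal, ← trigC_conj]

/-- An integrable majorant of the multipliers of the normalized sums. -/
noncomputable def majorant (D : ℝ) (n : ℕ) (g : ℝ) : ℝ :=
  -- On this range `Dg⁴/n` can be as large as `Dg²`, so the minimum is what keeps the family
  -- dominated by `exp (g²/4)`.
  if |g| ≤ √(n : ℝ) then min (Real.exp (D * (g ^ 4 / n))) (Real.exp (g ^ 2 / 4))
  else Real.exp (g ^ 2 / 4)

lemma measurable_majorant (D : ℝ) (n : ℕ) : Measurable (majorant D n) := by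
  unfold majorant
  exact Measurable.ite (measurableSet_le (by fun_prop) (by fun_prop)) (by fun_prop) (by fun_prop)

lemma majorant_nonneg (D : ℝ) (n : ℕ) (g : ℝ) : 0 ≤ majorant D n g := by
  unfold majorant
  split_ifs <;> positivity

lemma majorant_le (D : ℝ) (n : ℕ) (g : ℝ) : majorant D n g ≤ Real.exp (g ^ 2 / 4) := by
  unfold majorant
  split_ifs
  · exact min_le_right _ _
  · exact le_rfl

lemma integrable_exp_sq_div_four :
    Integrable (fun g : ℝ => Real.exp (g ^ 2 / 4)) (gaussianReal 0 1) := by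
  rw [gaussianReal_of_var_ne_zero 0 one_ne_zero,
    integrable_withDensity_iff_integrable_smul' (measurable_gaussianPDF 0 1)
      (ae_of_all _ fun x => gaussianPDF_lt_top)]
  have h := (integrable_exp_neg_mul_sq (b := 1 / 4) (by norm_num)).const_mul (√(2 * π))⁻¹
  convert! h using 1
  ext x
  rw [toReal_gaussianPDF, ← stdNormalDensity_eq, stdNormalDensity, smul_eq_mul, mul_assoc,
    ← Real.exp_add]
  congr 2
  ring

lemma tendsto_integral_majorant (D : ℝ) :
    Tendsto (fun n => ∫ g, majorant D n g ∂(gaussianReal 0 1)) atTop (𝓝 1) := by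
  have h1 : ∫ _ : ℝ, (1 : ℝ) ∂(gaussianReal 0 1) = 1 := by simp
  rw [← h1]
  refine tendsto_integral_of_dominated_convergence (fun g => Real.exp (g ^ 2 / 4))
    (fun n => (measurable_majorant D n).aestronglyMeasurable) integrable_exp_sq_div_four
    (fun n => ae_of_all _ fun g => ?_) (ae_of_all _ fun g => ?_)
  · rw [Real.norm_of_nonneg (majorant_nonneg D n g)]
    exact majorant_le D n g
  · have hd : Tendsto (fun n : ℕ => D * (g ^ 4 / n)) atTop (𝓝 0) := by
      simpa using (tendsto_const_div_atTop_nhds_zero_nat (g ^ 4)).const_mul D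
    have h2 : Tendsto (fun n : ℕ => min (Real.exp (D * (g ^ 4 / n))) (Real.exp (g ^ 2 / 4)))
        atTop (𝓝 1) := by
      have := ((Real.continuous_exp.tendsto 0).comp hd).min
        (tendsto_const_nhds (x := Real.exp (g ^ 2 / 4)))
      rwa [Real.exp_zero, min_eq_left (Real.one_le_exp (by positivity))] at this
    refine h2.congr' ?_
    have h3 : Tendsto (fun n : ℕ => √(n : ℝ)) atTop atTop :=
      Real.tendsto_sqrt_atTop.comp tendsto_natCast_atTop_atTop
    filter_upwards [h3.eventually_ge_atTop |g|] with n hn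
    rw [majorant, if_pos hn]

/-- At height `u = g/√n` the `n`-th power turns `exp (u²/4)` into `exp (g²/4)` and `exp (Du⁴)` into
`exp (Dg⁴/n)`, whatever `x` is. -/
lemma gaussT_sumMult_re_le {N : ℕ} {a b : ℕ → ℝ} {c D : ℝ} (hb : ∀ y u : ℝ,
      ‖1 - c * trigC N a b (y + Complex.I * u)‖ ≤ Real.exp (u ^ 2 / 4) ∧
      (|u| ≤ 1 → ‖1 - c * trigC N a b (y + Complex.I * u)‖ ≤ Real.exp (D * u ^ 4)))
    {n : ℕ} (hn : 1 ≤ n) (x : ℝ) :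
    (gaussT (sumMult N a b c n) x).re ≤ ∫ g, majorant D n g ∂(gaussianReal 0 1) := by
  have hn0 : (0 : ℝ) < n := by exact_mod_cast hn
  have hs0 : 0 < √(n : ℝ) := Real.sqrt_pos.2 hn0
  have hss : √(n : ℝ) ^ 2 = n := Real.sq_sqrt hn0.le
  refine (Complex.re_le_norm _).trans ?_
  refine norm_integral_le_of_norm_le ?_ (ae_of_all _ fun g => ?_)
  · refine integrable_exp_sq_div_four.mono' (measurable_majorant D n).aestronglyMeasurable
      (ae_of_all _ fun g => ?_)
    rw [Real.norm_of_nonneg (majorant_nonneg D n g)]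
    exact majorant_le D n g
  · obtain ⟨h1, h2⟩ := hb ((√(n : ℝ))⁻¹ * x) ((√(n : ℝ))⁻¹ * g)
    have he : sumMult N a b c n (x + Complex.I * g) = (1 - c * trigC N a b
        (((√(n : ℝ))⁻¹ * x : ℝ) + Complex.I * ((√(n : ℝ))⁻¹ * g : ℝ))) ^ n := by
      simp only [sumMult]
      push_cast
      ring_nf
    rw [he, norm_pow]
    have k1 : ‖1 - c * trigC N a b
        (((√(n : ℝ))⁻¹ * x : ℝ) + Complex.I * ((√(n : ℝ))⁻¹ * g : ℝ))‖ ^ n ≤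
          Real.exp (g ^ 2 / 4) := by
      refine (pow_le_pow_left₀ (norm_nonneg _) h1 n).trans (le_of_eq ?_)
      rw [← Real.exp_nat_mul, mul_pow, inv_pow, hss]
      congr 1
      field_simp
    unfold majorant
    split_ifs with hg
    · refine le_min ?_ k1
      have hu : |(√(n : ℝ))⁻¹ * g| ≤ 1 := by
        rw [abs_mul, abs_of_pos (inv_pos.2 hs0), inv_mul_le_iff₀ hs0, mul_one]
        exact hg
      refine (pow_le_pow_left₀ (norm_nonneg _) (h2 hu) n).trans (le_of_eq ?_)
      rw [← Real.exp_nat_mul, mul_pow, inv_pow, show 4 = 2 * 2 from rfl, pow_mul √(n : ℝ), hss]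
      congr 1
      field_simp
    · exact k1

/-! ### Moments, transforms and normalized sums. -/

/-- The factor `1 - cP` is `1 + O(t³)` at 0, so the first two moments are those of the normal law.
-/
lemma moments_of_laplace {μ : Measure ℝ} [IsProbabilityMeasure μ] {N : ℕ} {a b : ℕ → ℝ} {c : ℝ}
    (h0 : trigR N a b 0 = 0) (h1 : deriv (trigR N a b) 0 = 0)
    (h2 : deriv (deriv (trigR N a b)) 0 = 0)
    (hL : HasLaplaceTransform (fun x : ℝ => x) μ
      (fun t => (1 - c * trigR N a b t) * Real.exp (t ^ 2 / 2))) :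
    ∫ x, x ∂μ = 0 ∧ variance (fun x : ℝ => x) μ = 1 := by
  have hset : integrableExpSet (fun x : ℝ => x) μ = Set.univ :=
    Set.eq_univ_of_forall fun t => (hL t).1
  have hint : (0 : ℝ) ∈ interior (integrableExpSet (fun x : ℝ => x) μ) := by
    simp [hset]
  have hmgf : mgf (fun x : ℝ => x) μ = fun t => (1 - c * trigR N a b t) * Real.exp (t ^ 2 / 2) :=
    funext fun t => (hL t).2
  have hE (t : ℝ) : HasDerivAt (fun t : ℝ => Real.exp (t ^ 2 / 2)) (Real.exp (t ^ 2 / 2) * t) t := by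
    have := ((hasDerivAt_pow 2 t).div_const 2).exp
    exact this.congr_deriv (by simp)
  have hd (t : ℝ) : HasDerivAt (trigR N a b) (deriv (trigR N a b) t) t :=
    (analyticAt_trigR N a b t).differentiableAt.hasDerivAt
  have hdd (t : ℝ) : HasDerivAt (deriv (trigR N a b)) (deriv (deriv (trigR N a b)) t) t :=
    (analyticAt_trigR N a b t).deriv.differentiableAt.hasDerivAt
  have hG (t : ℝ) : HasDerivAt (fun t => 1 - c * trigR N a b t) (-(c * deriv (trigR N a b) t)) t :=
    ((hd t).const_mul c).const_sub 1
  have hD1 : deriv (fun t => (1 - c * trigR N a b t) * Real.exp (t ^ 2 / 2)) =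
      fun t => -(c * deriv (trigR N a b) t) * Real.exp (t ^ 2 / 2) +
        (1 - c * trigR N a b t) * (Real.exp (t ^ 2 / 2) * t) :=
    funext fun t => ((hG t).mul (hE t)).deriv
  have hD2 : deriv (deriv (fun t => (1 - c * trigR N a b t) * Real.exp (t ^ 2 / 2))) 0 = 1 := by
    rw [hD1]
    have := (((((hdd 0).const_mul c).neg).mul (hE 0)).add
      ((hG 0).mul ((hE 0).mul (hasDerivAt_id 0)))).deriv
    refine Eq.trans this ?_
    simp [h0, h1, h2]
  have hm : ∫ x, x ∂μ = 0 := by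
    rw [← deriv_mgf_zero hint, hmgf, hD1]
    simp [h1]
  refine ⟨hm, ?_⟩
  have hm2 : ∫ x, x ^ 2 ∂μ = 1 := by
    have := iteratedDeriv_mgf_zero hint 2
    rw [hmgf, iteratedDeriv_succ, iteratedDeriv_one, hD2] at this
    simpa using this.symm
  rw [variance_eq_sub (memLp_of_mem_interior_integrableExpSet hint 2), hm]
  simpa using hm2

lemma charFun_normalizedSum {Ω : Type*} [MeasurableSpace Ω] {Pr : Measure Ω}
    [IsProbabilityMeasure Pr] {X : ℕ → Ω → ℝ} {μ : Measure ℝ} (hX : iIndepFun X Pr)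
    (hμ : ∀ k, HasLaw (X k) μ Pr) (n : ℕ) (s : ℝ) :
    charFun (Pr.map (normalizedSum X n)) s = charFun μ ((√(n : ℝ))⁻¹ * s) ^ n := by
  have hXm (k : ℕ) : AEMeasurable (X k) Pr := (hμ k).aemeasurable
  have h1 : Pr.map (normalizedSum X n) =
      (Pr.map (fun ω => ∑ k ∈ Finset.range n, X k ω)).map (fun x => (√(n : ℝ))⁻¹ * x) := by
    rw [AEMeasurable.map_map_of_aemeasurable (by fun_prop) (by fun_prop)]
    congr 1
    ext ω
    simp [normalizedSum, div_eq_inv_mul]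
  rw [h1, charFun_map_mul, iIndepFun.charFun_map_fun_finsetSum_eq_prod (fun k _ => hXm k)
    (hX.restrict _), Finset.prod_apply]
  simp [(hμ _).map_eq]

lemma gaussT_one_sub_trigC (N : ℕ) (a b : ℕ → ℝ) (c x : ℝ) :
    gaussT (fun z => 1 - c * trigC N a b z) x =
      ((1 - c * trigR N (fun k => Real.exp (k ^ 2 / 2) * a k)
        (fun k => Real.exp (k ^ 2 / 2) * b k) x : ℝ) : ℂ) := by
  have h := gaussT_trigC N a b x
  simp only [gaussT] at h ⊢
  rw [integral_sub (integrable_const _) ((expSum_integrable (trigC_mem N a b) x).const_mul _),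
    integral_const_mul, h]
  simp

lemma isTrigPoly_one_sub (N : ℕ) (a b : ℕ → ℝ) (c : ℝ) :
    IsTrigPoly N (fun x => 1 - c * trigR N a b x) := by
  refine ⟨fun k => (if k = 0 then 1 else 0) - c * a k, fun k => -(c * b k), fun t => ?_⟩
  beta_reduce
  rw [if_pos rfl, trigR, mul_add, Finset.mul_sum, ← sub_sub, sub_eq_add_neg (1 - c * a 0),
    ← Finset.sum_neg_distrib]
  congr 1
  refine Finset.sum_congr rfl fun k hk => ?_
  have : k ≠ 0 := by have := (Finset.mem_Icc.1 hk).1; omega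
  simp only [this, if_false]
  ring

/-- The transform of the law with a non-negative density `q` against the normal law, where `q` is
the Gaussian average of an exponential sum `f`. -/
lemma complex_laplace_withDensity {f : ℂ → ℂ} (hf : f ∈ expSum) {q : ℝ → ℝ} (hq : ∀ x, 0 ≤ q x)
    (hqm : Measurable q) (hfq : ∀ x, gaussT f x = q x) (w : ℂ) :
    Integrable (fun x : ℝ => Complex.exp (w * x))
      ((gaussianReal 0 1).withDensity fun x => ENNReal.ofReal (q x)) ∧
    ∫ x : ℝ, Complex.exp (w * x) ∂((gaussianReal 0 1).withDensity fun x => ENNReal.ofReal (q x)) =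
      f w * Complex.exp (w ^ 2 / 2) := by
  obtain ⟨h1, h2⟩ := (gaussT_laplace hf).2 w
  have he (x : ℝ) : (ENNReal.ofReal (q x)).toReal • Complex.exp (w * x) =
      Complex.exp (w * x) * gaussT f x := by
    rw [ENNReal.toReal_ofReal (hq x), hfq, Complex.real_smul, mul_comm]
  constructor
  · rw [integrable_withDensity_iff_integrable_smul' (by fun_prop) (by simp)]
    simpa only [he] using h1
  · rw [integral_withDensity_eq_integral_toReal_smul (by fun_prop) (by simp), ← h2]
    simp only [he]

lemma hasLaplaceTransform_withDensity {N : ℕ} {a b : ℕ → ℝ} {c : ℝ} {μ : Measure ℝ}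
    (h : ∀ w : ℂ, Integrable (fun x : ℝ => Complex.exp (w * x)) μ ∧
      ∫ x : ℝ, Complex.exp (w * x) ∂μ = (1 - c * trigC N a b w) * Complex.exp (w ^ 2 / 2)) :
    HasLaplaceTransform (fun x : ℝ => x) μ
      (fun t => (1 - c * trigR N a b t) * Real.exp (t ^ 2 / 2)) := by
  intro t
  obtain ⟨h1, h2⟩ := h t
  have he (x : ℝ) : Complex.exp (t * x) = (Real.exp (t * x) : ℂ) := by push_cast; rfl
  simp only [he] at h1 h2
  refine ⟨h1.re, ?_⟩
  rw [integral_complex_ofReal, trigC_ofReal] at h2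
  exact_mod_cast h2

/-- The Gaussian factor is reproduced by rescaling and taking the `n`-th power, so only the
multiplier changes. At `n = 0` the left side is 1 and the Gaussian factor on the right remains. -/
lemma charFun_sumMult {N : ℕ} {a b : ℕ → ℝ} {c : ℝ} {μ : Measure ℝ}
    (h : ∀ w : ℂ, ∫ x : ℝ, Complex.exp (w * x) ∂μ =
      (1 - c * trigC N a b w) * Complex.exp (w ^ 2 / 2)) {n : ℕ} (hn : 1 ≤ n) (s : ℝ) :
    charFun μ ((√(n : ℝ))⁻¹ * s) ^ n =
      sumMult N a b c n (s * Complex.I) * Complex.exp ((s * Complex.I) ^ 2 / 2) := by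
  have hn0 : (n : ℂ) ≠ 0 := by exact_mod_cast (by omega : n ≠ 0)
  have hss : ((√(n : ℝ) : ℝ) : ℂ) ^ 2 = n := by
    exact_mod_cast Real.sq_sqrt (Nat.cast_nonneg n)
  have h1 := h (((√(n : ℝ))⁻¹ * s : ℝ) * Complex.I)
  rw [charFun_apply_real]
  have he (x : ℝ) : (((√(n : ℝ))⁻¹ * s : ℝ) : ℂ) * x * Complex.I =
    (((√(n : ℝ))⁻¹ * s : ℝ) : ℂ) * Complex.I * x := by ring
  simp only [he]
  rw [h1, mul_pow, ← Complex.exp_nat_mul, sumMult]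
  push_cast
  congr 2
  · ring_nf
  · rw [mul_pow, mul_pow, mul_pow, inv_pow, hss]
    field_simp

/-- The densities of the normalized sums, and convergence in the Tsallis distance. -/
lemma tendsto_tsallisInfty {N : ℕ} {a b : ℕ → ℝ} {c D : ℝ} {μ : Measure ℝ}
    (h : ∀ w : ℂ, ∫ x : ℝ, Complex.exp (w * x) ∂μ =
      (1 - c * trigC N a b w) * Complex.exp (w ^ 2 / 2))
    (hb : ∀ y u : ℝ, ‖1 - c * trigC N a b (y + Complex.I * u)‖ ≤ Real.exp (u ^ 2 / 4) ∧
      (|u| ≤ 1 → ‖1 - c * trigC N a b (y + Complex.I * u)‖ ≤ Real.exp (D * u ^ 4)))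
    {Ω : Type*} [MeasurableSpace Ω] (Pr : Measure Ω) [IsProbabilityMeasure Pr]
    (X : ℕ → Ω → ℝ) (hX : iIndepFun X Pr) (hμ : ∀ k, HasLaw (X k) μ Pr) :
    ∃ p : ℕ → ℝ → ℝ,
      (∀ n : ℕ, 1 ≤ n → IsDensity (p n) (Pr.map (normalizedSum X n))) ∧
      Tendsto (fun n => tsallisInfty (p n)) atTop (𝓝 0) := by
  have hXm (k : ℕ) : AEMeasurable (X k) Pr := (hμ k).aemeasurable
  have hZ (n : ℕ) : AEMeasurable (normalizedSum X n) Pr := by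
    unfold normalizedSum
    fun_prop
  have hprob (n : ℕ) : IsProbabilityMeasure (Pr.map (normalizedSum X n)) :=
    Measure.isProbabilityMeasure_map (hZ n)
  let q : ℕ → ℝ → ℝ := fun n x => (gaussT (sumMult N a b c n) x).re
  have hqc (n : ℕ) (x : ℝ) : gaussT (sumMult N a b c n) x = q n x :=
    (Complex.ext (by simp [q]) (by simpa using gaussT_im (sumMult_conj N a b c n) x))
  have hqm (n : ℕ) : Measurable (q n) :=
    (Complex.continuous_re.comp (gaussT_laplace (sumMult_mem N a b c n)).1).measurable
  have hqi (n : ℕ) : Integrable (q n) (gaussianReal 0 1) := by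
    simpa using ((gaussT_laplace (sumMult_mem N a b c n)).2 0).1.re
  have hdens (n : ℕ) (hn : 1 ≤ n) :
      -- Truncation supplies the pointwise non-negativity demanded of a density.
      IsDensity (fun x => max (q n x) 0 * stdNormalDensity x) (Pr.map (normalizedSum X n)) := by
    rw [eq_withDensity_of_charFun (ν := Pr.map (normalizedSum X n)) (hqm n) (hqi n) fun s => ?_]
    · exact isDensity_gaussian_withDensity (hqm n)
    · rw [charFun_normalizedSum hX hμ, charFun_sumMult h hn,
        ← ((gaussT_laplace (sumMult_mem N a b c n)).2 (s * Complex.I)).2]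
      refine integral_congr_ae (ae_of_all _ fun x => ?_)
      simp only [hqc]
      ring_nf
  refine ⟨fun n x => max (q n x) 0 * stdNormalDensity x, hdens, ?_⟩
  have hup : Tendsto (fun n => (((∫ g, majorant D n g ∂(gaussianReal 0 1)) - 1 : ℝ) : EReal))
      atTop (𝓝 0) := by
    have := (tendsto_integral_majorant D).sub_const 1
    rw [sub_self] at this
    exact_mod_cast (continuous_coe_real_ereal.tendsto 0).comp this
  refine tendsto_of_tendsto_of_tendsto_of_le_of_le' tendsto_const_nhds hup ?_ ?_
  · filter_upwards [eventually_ge_atTop 1] with n hn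
    exact tsallisInfty_nonneg (hdens n hn)
  · filter_upwards [eventually_ge_atTop 1] with n hn
    exact tsallisInfty_le fun x => max_le (gaussT_sumMult_re_le hb hn x)
      (integral_nonneg (majorant_nonneg D n))

/-! ### Assembly. -/

lemma nonneg_of_smallestPeriod {P : ℝ → ℝ} {h : ℝ} (hh : IsSmallestPeriod P h) (hP0 : P 0 = 0)
    (hPnn : ∀ t : ℝ, 0 < t → t < h → 0 ≤ P t) (t : ℝ) : 0 ≤ P t := by
  obtain ⟨y, hy, hPy⟩ := hh.1.2.exists_mem_Ico₀ hh.1.1 t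
  rw [hPy]
  rcases hy.1.eq_or_lt with rfl | hy0
  · exact hP0.ge
  · exact hPnn y hy0 hy.2

theorem corollary9p3 (N : ℕ) (P : ℝ → ℝ) (h : ℝ)
    (hP : IsTrigPoly N P) (hh : IsSmallestPeriod P h)
    (hP0 : P 0 = 0) (hP1 : deriv P 0 = 0) (hP2 : deriv (deriv P) 0 = 0)
    (hPnn : ∀ t : ℝ, 0 < t → t < h → 0 ≤ P t) :
    ∃ c₀ : ℝ, 0 < c₀ ∧ ∀ c : ℝ, 0 < c → c < c₀ →
      -- `μ` is the law of `X`
      ∃ μ : Measure ℝ, IsProbabilityMeasure μ ∧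
        HasLaplaceTransform (fun x : ℝ => x) μ
          (fun t => (1 - c * P t) * Real.exp (t ^ 2 / 2)) ∧
        IsStrictlySubgaussian (fun x : ℝ => x) μ ∧
        variance (fun x : ℝ => x) μ = 1 ∧
        (∃ q : ℝ → ℝ, IsTrigPoly N q ∧ (∀ x, 0 ≤ q x) ∧
          IsDensity (fun x => q x * stdNormalDensity x) μ) ∧
        ((∀ t : ℝ, 0 < t → t < h → 0 < P t) →
          ∀ (Ω : Type*) [MeasurableSpace Ω] (Pr : Measure Ω) [IsProbabilityMeasure Pr]
            (X : ℕ → Ω → ℝ), iIndepFun X Pr → (∀ k, HasLaw (X k) μ Pr) →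
            ∃ p : ℕ → ℝ → ℝ,
              (∀ n : ℕ, 1 ≤ n → IsDensity (p n) (Pr.map (normalizedSum X n))) ∧
              Tendsto (fun n => tsallisInfty (p n)) atTop (𝓝 0)) := by
  have hnn := nonneg_of_smallestPeriod hh hP0 hPnn
  obtain ⟨a, b, hab⟩ := hP
  obtain rfl : P = trigR N a b := funext hab
  -- The threshold is fixed before strict positivity is assumed, hence the case split; without
  -- positivity any `c₁` will do.
  have hc₁ : ∃ c₁ : ℝ, 0 < c₁ ∧ ((∀ t : ℝ, 0 < t → t < h → 0 < trigR N a b t) →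
      ∃ D : ℝ, ∀ c : ℝ, 0 < c → c < c₁ → ∀ y u : ℝ,
      ‖1 - c * trigC N a b (y + Complex.I * u)‖ ≤ Real.exp (u ^ 2 / 4) ∧
      (|u| ≤ 1 → ‖1 - c * trigC N a b (y + Complex.I * u)‖ ≤ Real.exp (D * u ^ 4))) := by
    by_cases hpos : ∀ t : ℝ, 0 < t → t < h → 0 < trigR N a b t
    · obtain ⟨c₁, hc₁, H⟩ := exists_norm_one_sub_le hh.1.1 hh.1.2 hpos hP0 hP1 hP2
      exact ⟨c₁, hc₁, fun _ => H⟩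
    · exact ⟨1, one_pos, fun h => absurd h hpos⟩
  obtain ⟨c₁, hc₁, H⟩ := hc₁
  let Q : ℝ → ℝ := trigR N (fun k => Real.exp (k ^ 2 / 2) * a k)
    (fun k => Real.exp (k ^ 2 / 2) * b k)
  obtain ⟨B, hB0, hB⟩ : ∃ B : ℝ, 0 ≤ B ∧ ∀ x, Q x ≤ B :=
    ⟨_, by positivity, fun x => (le_abs_self _).trans (abs_trigR_le N _ _ x)⟩
  -- The second bound gives `cQ ≤ cB < 1`, so `q = 1 - cQ` stays non-negative; the added 1 covers `B
  -- = 0`.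
  refine ⟨min c₁ (1 / (B + 1)), by positivity, fun c hc hcc => ?_⟩
  rw [lt_min_iff, lt_div_iff₀ (by positivity)] at hcc
  let q : ℝ → ℝ := fun x => 1 - c * Q x
  have hq0 (x : ℝ) : 0 ≤ q x := by
    have := mul_le_mul_of_nonneg_left (hB x) hc.le
    simp only [q]
    linarith [hcc.2]
  have hqm : Measurable q :=
    (continuous_const.sub (continuous_const.mul (continuous_trigR N _ _))).measurable
  have hw := complex_laplace_withDensity (one_sub_trigC_mem N a b c) hq0 hqm
    (gaussT_one_sub_trigC N a b c)
  have hd := isDensity_gaussian_withDensity hqm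
  generalize (gaussianReal 0 1).withDensity (fun x => ENNReal.ofReal (q x)) = μ at hw hd
  have hL := hasLaplaceTransform_withDensity hw
  have hprob : IsProbabilityMeasure μ := by
    rw [isProbabilityMeasure_iff_real]
    -- The total mass is the Laplace transform at 0.
    simpa [hP0] using (hL 0).2
  obtain ⟨hmean, hvar⟩ := moments_of_laplace hP0 hP1 hP2 hL
  refine ⟨μ, hprob, hL, ⟨aemeasurable_id', fun t => (hL t).1, hmean, fun t => ?_⟩, hvar,
    ⟨q, isTrigPoly_one_sub N _ _ c, hq0, ?_⟩, fun hpos Ω _ Pr _ X hX hμ => ?_⟩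
  · rw [(hL t).2, hvar, one_mul]
    exact mul_le_of_le_one_left (Real.exp_pos _).le
      (sub_le_self _ (mul_nonneg hc.le (hnn t)))
  · simpa only [max_eq_left (hq0 _)] using hd
  · obtain ⟨D, hD⟩ := H hpos
    exact tendsto_tsallisInfty (fun w => (hw w).2) (hD c hc hcc.1) Pr X hX hμ
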